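/- Let $V$ be a finite-dimensional real vector space and let $\Phi\subset V$ be a finite reduced crystallographic root system (with Weyl-group-invariant inner product $\langle\cdot,\cdot\rangle$ and coroots $\alpha^\vee=2\alpha/\langle\alpha,\alpha\rangle$) with simple roots $\alpha_1,\dots,\alpha_n$ and positive roots $\Phi^+$. For $x\in V$ let $\tau_x$ be the translation by $x$. Let $W_a$ be the affine Weyl group, generated by all the affine reflections $s_{\alpha,k}(x)=x-(\langle x,\alpha^\vee\rangle-k)\alpha$ with $\alpha\in\Phi$, $k\in\mathbb Z$. Put $A_e=\{x : 0<\langle x,\alpha^\vee\rangle<1\ \ \forall\alpha\in\Phi^+\}$ and $A_w=wA_e$ for $w\in W_a$. The Shi coefficients $k(w,\alpha)$ are the integers with $A_w=\{x : k(w,\alpha)<\langle x,\alpha^\vee\rangle<k(w,\alpha)+1\ \ \forall \alpha\in\Phi^+\}$, and $\iota(w)=(k(w,\alpha))_{\alpha\in\Phi^+}$ is the Shi vector of $w$. The alcoves $A_w$ and $A_{w'}$ have the same orientation if $w'=\tau_xw$ for some $x\in\mathbb Z\Phi$. For $\theta\in\Phi^+$ let $P_\theta$ be the linear polynomial with $\theta^\vee=P_\theta(\alpha_1^\vee,\dots,\alpha_n^\vee)$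 and let $h(\theta^\vee)$ be the height of $\theta^\vee$ (the sum of the coefficients of $P_\theta$). A vector $\lambda\in\mathbb N^{\Phi^+}$ is admitted if $\lambda_\theta\le h(\theta^\vee)-1$ for all $\theta\in\Phi^+$ and if, for all $\alpha,\beta\in\Phi^+$ with $\alpha+\beta\in\Phi^+$, $$\|\alpha\|^2\lambda_\alpha+\|\beta\|^2\lambda_\beta+1\le\|\alpha+\beta\|^2(\lambda_{\alpha+\beta}+1)\le\|\alpha\|^2\lambda_\alpha+\|\beta\|^2\lambda_\beta+\|\alpha\|^2+\|\beta\|^2+\|\alpha+\beta\|^2-1,$$ where the squared lengths are taken for the invariant form $(x,y)\mapsto\sum_{\beta\in\Phi}\langle x,\beta^\vee\rangle\langle y,\beta^\vee\rangle$, which is integral on roots. Let $X_{W_a}[\lambda]\subset\mathbb R^{\Phi^+}$ be the common zero set of the polynomials $P_\theta(X_{\alpha_1},\dots,X_{\alpha_n})+\lambda_\theta-X_\theta$ with $\theta\in\Phi^+$. The Shi variety is $\widehat X_{W_a}=\bigcup_{\lambda\text{ admitted}}X_{W_a}[\lambda]$. Let $w,w'\in W_a$ be such that $\iota(w)$ and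 $\iota(w')$ lie in the same irreducible component of $\widehat X_{W_a}$. Write $k_j=k(w,\alpha_j)$ and $k'_j=k(w',\alpha_j)$, with the simple roots numbered as in Bourbaki: in type $B_n$ the root $\alpha_n$ is the short simple root, in type $C_n$ it is the long one, and in type $D_n$ the roots $\alpha_{n-1},\alpha_n$ are the two ends of the fork attached to $\alpha_{n-2}$. Let $I_m$ be the set of odd integers in $\{1,\dots,m\}$. Then: * **Type $A_n$ ($n\ge1$).** $A_w$ and $A_{w'}$ have the same orientation if and only if $\sum_{j=1}^n j\,k_j=\sum_{j=1}^n j\,k'_j$ in $\mathbb Z/(n+1)\mathbb Z$. * **Type $B_n$ ($n\ge2$).** They have the same orientation if and only if $k_n=k'_n$ in $\mathbb Z/2\mathbb Z$. * **Type $C_n$ ($n\ge2$).** They have the same orientation if and only if $\sum_{j\in I_n}k_j=\sum_{j\in I_n}k'_j$ in $\mathbb Z/2\mathbb Z$. * **Type $D_n$ ($n\ge4$).** They have the same orientation if and only if all three of the following hold: (i) $k_{n-1}-k'_{n-1}=k_n-k'_n$ in $\mathbb Z/2\mathbb Z$; (ii) $\sum_{j\in I_{n-2}}2k_j+n\,k_{n-1}+(n-2)k_n=\sum_{j\in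 I_{n-2}}2k'_j+n\,k'_{n-1}+(n-2)k'_n$ in $\mathbb Z/4\mathbb Z$; (iii) $\sum_{j\in I_{n-2}}2k_j+(n-2)k_{n-1}+n\,k_n=\sum_{j\in I_{n-2}}2k'_j+(n-2)k'_{n-1}+n\,k'_n$ in $\mathbb Z/4\mathbb Z$. -/

import Mathlib

/-
Affine Weyl groups, alcoves, Shi coefficients and the Shi variety of a root system.

Root systems are Mathlib's finite crystallographic reduced root pairings over `ℝ`, with a base; the
pairing `⟨x, α^∨⟩` is `P.coroot' α x`.  The roots need not span the ambient space `V`.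
-/

noncomputable section

namespace ShiVariety

variable {I V N : Type*} [AddCommGroup V] [Module ℝ V] [AddCommGroup N] [Module ℝ N]

/-- The translation `τ_x` of `V`. -/
def translation (x : V) : V ≃ᵃ[ℝ] V := AffineEquiv.constVAdd ℝ V x

theorem translation_apply (x y : V) : translation x y = x + y := rfl

/-- The affine reflection `s_{α,k} : x ↦ x - (⟨x, α^∨⟩ - k) α`. -/
def affineReflection (P : RootPairing I ℝ V N) (i : I) (k : ℤ) : V ≃ᵃ[ℝ] V :=
  translation ((k : ℝ) • P.root i) * (P.reflection i).toAffineEquiv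

theorem affineReflection_apply (P : RootPairing I ℝ V N) (i : I) (k : ℤ) (x : V) :
    affineReflection P i k x = x - (P.coroot' i x - k) • P.root i := by
  change (k : ℝ) • P.root i + P.reflection i x = _
  rw [RootPairing.reflection_apply, sub_smul]
  abel

/-- The affine Weyl group `W_a`, generated by all the affine reflections `s_{α,k}`. -/
def affineWeylGroup (P : RootPairing I ℝ V N) : Subgroup (V ≃ᵃ[ℝ] V) :=
  Subgroup.closure {g | ∃ (i : I) (k : ℤ), g = affineReflection P i k}

/-- The strip `H_{α,k}^1 = {x | k < ⟨x, α^∨⟩ < k + 1}`. -/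
def strip (P : RootPairing I ℝ V N) (i : I) (k : ℤ) : Set V :=
  {x | (k : ℝ) < P.coroot' i x ∧ P.coroot' i x < k + 1}

/-- Elements of the affine Weyl group permute the coroot functionals up to integers. -/
theorem exists_perm_of_mem_affineWeylGroup (P : RootPairing I ℝ V N) [P.IsCrystallographic]
    {g : V ≃ᵃ[ℝ] V} (hg : g ∈ affineWeylGroup P) :
    ∃ (σ : Equiv.Perm I) (c : I → ℤ), ∀ i x, P.coroot' i (g x) = P.coroot' (σ i) x + c i := by
  induction hg using Subgroup.closure_induction with
  | mem g hg =>
    obtain ⟨j, k, rfl⟩ := hg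
    refine ⟨P.reflectionPerm j, fun i => k * P.pairingIn ℤ j i, fun i x => ?_⟩
    have h1 : P.coroot (P.reflectionPerm j i) = P.coroot i - P.pairing j i • P.coroot j :=
      (P.reflectionPerm_coroot j i).symm
    have h2 : ((P.pairingIn ℤ j i : ℤ) : ℝ) = P.pairing j i := P.algebraMap_pairingIn ℤ j i
    simp only [affineReflection_apply, RootPairing.coroot', map_sub, map_smul, h1]
    push_cast
    simp only [LinearMap.sub_apply, LinearMap.smul_apply, smul_eq_mul, h2,
      RootPairing.coroot_root_eq_pairing]
    ring
  | one => exact ⟨1, 0, fun i x => by simp⟩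
  | mul g h _ _ hg hh =>
    obtain ⟨σ, c, hσ⟩ := hg
    obtain ⟨τ, d, hτ⟩ := hh
    refine ⟨τ * σ, fun i => d (σ i) + c i, fun i x => ?_⟩
    rw [AffineEquiv.coe_mul, Function.comp_apply, hσ, hτ]
    push_cast
    change P.coroot' (τ (σ i)) x + d (σ i) + c i = P.coroot' (τ (σ i)) x + (d (σ i) + c i)
    ring
  | inv g _ hg =>
    obtain ⟨σ, c, hσ⟩ := hg
    refine ⟨σ⁻¹, fun i => - c (σ⁻¹ i), fun i x => ?_⟩
    have h := hσ (σ⁻¹ i) (g⁻¹ x)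
    rw [show σ (σ⁻¹ i) = i from σ.apply_symm_apply i, show g (g⁻¹ x) = x from g.apply_symm_apply x] at h
    push_cast
    linarith

section Base

variable {P : RootPairing I ℝ V N} (b : P.Base)

/-- The (indices of the) positive roots `Φ⁺`. -/
abbrev PosRoot : Type _ := {i : I // b.IsPos i}

/-- A simple root, as a positive root. -/
def simpleRoot (i : b.support) : PosRoot b := ⟨i, b.isPos_of_mem_support i.2⟩

/-- The fundamental alcove `A_e = ⋂_{α ∈ Φ⁺} H_{α,0}^1`. -/
def fundamentalAlcove : Set V := ⋂ i : PosRoot b, strip P i 0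

/-- The alcove `A_w = w A_e`. -/
def alcove (w : affineWeylGroup P) : Set V := (w : V ≃ᵃ[ℝ] V) '' fundamentalAlcove b

theorem mem_fundamentalAlcove {x : V} :
    x ∈ fundamentalAlcove b ↔ ∀ i, b.IsPos i → 0 < P.coroot' i x ∧ P.coroot' i x < 1 := by
  simp [fundamentalAlcove, strip]

theorem exists_alcove_eq [P.IsCrystallographic] (w : affineWeylGroup P) :
    ∃ k : PosRoot b → ℤ, alcove b w = ⋂ i : PosRoot b, strip P i (k i) := by
  classical
  obtain ⟨g, hg⟩ := w
  obtain ⟨σ, c, hσ⟩ := exists_perm_of_mem_affineWeylGroup P hg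
  let := P.indexNeg
  have hneg (i : I) (x : V) : P.coroot' (-i) x = - P.coroot' i x := by
    simp [RootPairing.coroot']
  have hpos (i : I) (h : ¬ b.IsPos i) : b.IsPos (-i) :=
    (RootPairing.Base.IsPos.neg_iff_not b i).2 h
  refine ⟨fun i => if b.IsPos (σ i) then c i else c i - 1, ?_⟩
  ext y
  simp only [alcove, Set.mem_image, Set.mem_iInter, mem_fundamentalAlcove]
  constructor
  · rintro ⟨x, hx, rfl⟩ ⟨i, hi⟩
    simp only [strip, Set.mem_ofPred_eq, hσ]
    split_ifs with h
    · have := hx _ h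
      constructor <;> linarith
    · have := hx _ (hpos _ h)
      rw [hneg] at this
      push_cast
      constructor <;> linarith
  · intro hy
    refine ⟨g.symm y, fun j hj => ?_, g.apply_symm_apply y⟩
    obtain ⟨i, rfl⟩ := σ.surjective j
    by_cases hi : b.IsPos i
    · have := hy ⟨i, hi⟩
      simp only [strip, Set.mem_ofPred_eq, if_pos hj] at this
      rw [← g.apply_symm_apply y, hσ] at this
      constructor <;> linarith [this.1, this.2]
    · have hi' := hpos i hi
      have e (x : V) : P.coroot' (σ (-i)) x + c (-i) = - (P.coroot' (σ i) x + c i) := by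
        rw [← hσ, ← hσ, hneg]
      have e0 := e 0
      simp only [map_zero, zero_add] at e0
      have e1 : P.coroot' (σ (-i)) = P.coroot' (-(σ i)) := by
        ext x
        rw [hneg]
        linarith [e x]
      have e2 : ¬ b.IsPos (σ (-i)) := by
        have : σ (-i) = -(σ i) := by
          apply P.coroot.injective
          exact P.flip.toPerfPair.injective e1
        rw [this, RootPairing.Base.IsPos.neg_iff_not]
        exact fun h => h hj
      have := hy ⟨-i, hi'⟩
      simp only [strip, Set.mem_ofPred_eq, if_neg e2] at this
      rw [← g.apply_symm_apply y, hσ, e1, hneg] at this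
      push_cast at this
      constructor <;> linarith [this.1, this.2]

/-- A point at which all positive coroots take values in `(0, 1)`. -/
theorem fundamentalAlcove_nonempty [Finite I] [P.IsCrystallographic] :
    (fundamentalAlcove b).Nonempty := by
  classical
  have := Fintype.ofFinite I
  obtain ⟨f, hf⟩ : ∃ f : Module.Dual ℝ N, ∀ i ∈ b.support, f (P.coroot i) = 1 := by
    obtain ⟨f, hf⟩ := LinearMap.exists_extend
      ((Module.Basis.span b.linearIndepOn_coroot).constr ℝ (fun _ => (1 : ℝ)))
    refine ⟨f, fun i hi => ?_⟩
    have h := LinearMap.congr_fun hf (Module.Basis.span b.linearIndepOn_coroot ⟨i, hi⟩)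
    rw [Module.Basis.constr_basis] at h
    have h' := Module.Basis.span_apply b.linearIndepOn_coroot ⟨i, hi⟩
    change f ((Module.Basis.span b.linearIndepOn_coroot ⟨i, hi⟩ :
      Submodule.span ℝ _) : N) = 1 at h
    rwa [h'] at h
  obtain ⟨x, rfl⟩ := P.toPerfPair.surjective f
  have hx (i : I) (hi : i ∈ b.support) : P.coroot' i x = 1 := hf i hi
  have key (i : I) : P.RootForm (P.root i) (P.root i) * P.coroot' i x
      = 2 * P.toLinearMap x (P.Polarization (P.root i)) := by
    have h := congrArg (P.toLinearMap x) (P.rootForm_self_smul_coroot i)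
    simpa using h
  have h0 (i : I) : 0 < P.RootForm (P.root i) (P.root i) :=
    P.rootForm_pos_of_ne_zero (Submodule.subset_span ⟨i, rfl⟩) (P.ne_zero i)
  have h1 (i : I) (hi : b.IsPos i) : 0 < P.coroot' i x := by
    obtain ⟨f, hsupp, hf, hsum⟩ := b.exists_root_eq_sum_int i
    have hle : 0 < f := by
      refine hf.resolve_right fun hlt => ?_
      rw [RootPairing.Base.isPos_iff, RootPairing.Base.height_eq_sum hsum] at hi
      exact absurd hi (not_lt.2 (Finset.sum_nonpos fun j _ => hlt.le j))
    have hk := key i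
    have hs : 0 < P.toLinearMap x (P.Polarization (P.root i)) := by
      have hj (j : I) (hj : j ∈ b.support) :
          0 < P.toLinearMap x (P.Polarization (P.root j)) := by
        have := key j
        rw [hx j hj] at this
        linarith [h0 j]
      obtain ⟨-, j, hfj⟩ := Pi.lt_def.1 hle
      rw [hsum, map_sum, map_sum]
      refine Finset.sum_pos' (fun l hl => ?_) ⟨j, hsupp hfj.ne', ?_⟩
      · rw [map_zsmul, map_zsmul]
        exact zsmul_nonneg (hj l hl).le (hle.le l)
      · rw [map_zsmul, map_zsmul]
        exact zsmul_pos (hj j (hsupp hfj.ne')) hfj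
    exact pos_of_mul_pos_right (by linarith) (h0 i).le
  have hS : 0 ≤ ∑ i, |P.coroot' i x| := Finset.sum_nonneg fun i _ => abs_nonneg _
  refine ⟨(1 + ∑ i, |P.coroot' i x|)⁻¹ • x, (mem_fundamentalAlcove b).2 fun i hi => ?_⟩
  have h2 : P.coroot' i x ≤ ∑ i, |P.coroot' i x| :=
    (le_abs_self _).trans (Finset.single_le_sum (f := fun i => |P.coroot' i x|)
      (fun i _ => abs_nonneg _) (Finset.mem_univ i))
  rw [map_smul, smul_eq_mul, inv_mul_eq_div, div_lt_one (by linarith)]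
  exact ⟨div_pos (h1 i hi) (by linarith), by linarith⟩

theorem existsUnique_alcove_eq [Finite I] [P.IsCrystallographic] (w : affineWeylGroup P) :
    ∃! k : PosRoot b → ℤ, alcove b w = ⋂ i : PosRoot b, strip P i (k i) := by
  obtain ⟨k, hk⟩ := exists_alcove_eq b w
  refine ⟨k, hk, fun l hl => funext fun i => ?_⟩
  obtain ⟨y, hy⟩ : (alcove b w).Nonempty := (fundamentalAlcove_nonempty b).image _
  have h1 : y ∈ strip P i (k i) := Set.mem_iInter.1 (hk ▸ hy) i
  have h2 : y ∈ strip P i (l i) := Set.mem_iInter.1 (hl ▸ hy) i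
  have h3 : (l i : ℝ) < k i + 1 := h2.1.trans h1.2
  have h4 : (k i : ℝ) < l i + 1 := h1.1.trans h2.2
  norm_cast at h3 h4
  omega

/-- The Shi coefficients `(k(w,α))_{α ∈ Φ⁺}` of `w`: the integers such that
`A_w = ⋂_{α ∈ Φ⁺} H_{α,k(w,α)}^1`. -/
def shiCoeff [Finite I] [P.IsCrystallographic] (w : affineWeylGroup P) : PosRoot b → ℤ := (existsUnique_alcove_eq b w).choose

theorem alcove_eq_iInter_strip [Finite I] [P.IsCrystallographic] (w : affineWeylGroup P) :
    alcove b w = ⋂ i : PosRoot b, strip P i (shiCoeff b w i) :=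
  (existsUnique_alcove_eq b w).choose_spec.1

/-- The Shi vector `ι(w)`, as a point of `ℝ^{Φ⁺}`. -/
def shiVector [Finite I] [P.IsCrystallographic] (w : affineWeylGroup P) : PosRoot b → ℝ := fun i => shiCoeff b w i

/-- The coefficient of `α^∨` in the expansion of `θ^∨` in simple coroots. -/
def corootCoeff (θ : PosRoot b) (i : b.support) : ℤ :=
  b.flip.toWeightBasisInt.repr (P.flip.rootSpanMem ℤ θ) i

theorem coroot_eq_sum_corootCoeff (θ : PosRoot b) :
    P.coroot θ = ∑ i : b.support, corootCoeff b θ i • P.coroot i := by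
  have h := congrArg (fun x : P.flip.rootSpan ℤ => (x : N))
    (b.flip.toWeightBasisInt.sum_repr (P.flip.rootSpanMem ℤ θ))
  simp only [Submodule.coe_sum, Submodule.coe_smul] at h
  simp only [RootPairing.Base.coe_toWeightBasisInt_apply] at h
  exact h.symm

/-- The linear polynomial `P_θ` in the variables attached to simple roots, determined by
`θ^∨ = P_θ(α_1^∨, …, α_n^∨)`, seen as a polynomial in the variables attached to `Φ⁺`. -/
def rootPolynomial (θ : PosRoot b) : MvPolynomial (PosRoot b) ℝ :=
  ∑ i : b.support, (corootCoeff b θ i : MvPolynomial (PosRoot b) ℝ) *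
    MvPolynomial.X (simpleRoot b i)

/-- Admissible vectors: `λ_θ ∈ {0, …, h(θ^∨) - 1}` for every positive root `θ`, where `h(θ^∨)` is
the height of the coroot `θ^∨`. -/
def IsAdmissible (l : PosRoot b → ℕ) : Prop := ∀ θ : PosRoot b, (l θ : ℤ) < b.flip.height θ

/-- The squared length `‖α‖²` of a root for the canonical Weyl group invariant form
`(x, y) ↦ ∑_{β ∈ Φ} ⟨x, β^∨⟩ ⟨y, β^∨⟩`.  This form takes integer values on roots, and on the span of
an irreducible root system every invariant inner product is a multiple of it. -/
def sqLength [Finite I] (P : RootPairing I ℝ V N) (i : I) : ℝ :=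
  letI := Fintype.ofFinite I
  P.RootForm (P.root i) (P.root i)

/-- The system `S[W_a]` of Shi's inequalities. -/
def SatisfiesShiInequalities [Finite I] (k : PosRoot b → ℤ) : Prop :=
  ∀ α β γ : PosRoot b, P.root γ = P.root α + P.root β →
    sqLength P α * k α + sqLength P β * k β + 1 ≤ sqLength P γ * (k γ + 1) ∧
    sqLength P γ * (k γ + 1) ≤ sqLength P α * k α + sqLength P β * k β
      + sqLength P α + sqLength P β + sqLength P γ - 1

/-- Admitted vectors: the admissible vectors that satisfy the system `S[W_a]`. -/
def IsAdmitted [Finite I] (l : PosRoot b → ℕ) : Prop :=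
  IsAdmissible b l ∧ SatisfiesShiInequalities b fun θ => (l θ : ℤ)

/-- The ideal `J_{W_a}[λ]` generated by the polynomials `P_θ[λ_θ] = P_θ + λ_θ - X_θ`. -/
def shiIdeal (l : PosRoot b → ℕ) : Ideal (MvPolynomial (PosRoot b) ℝ) :=
  Ideal.span (Set.range fun θ : PosRoot b =>
    rootPolynomial b θ + (l θ : MvPolynomial (PosRoot b) ℝ) - MvPolynomial.X θ)

/-- The affine variety `X_{W_a}[λ] = V(J_{W_a}[λ])`. -/
def shiSubspace (l : PosRoot b → ℕ) : Set (PosRoot b → ℝ) :=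
  MvPolynomial.zeroLocus ℝ (shiIdeal b l)

/-- The Shi variety: the union of the `X_{W_a}[λ]` over all admitted vectors `λ`. -/
def shiVariety [Finite I] : Set (PosRoot b → ℝ) :=
  ⋃ (l : PosRoot b → ℕ) (_ : IsAdmitted b l), shiSubspace b l

end Base

/-- Irreducible Zariski closed subsets of an affine space over `ℝ` (in terms of real points). -/
def IsIrreducibleZariskiClosed {S : Type*} (Z : Set (S → ℝ)) : Prop :=
  MvPolynomial.zeroLocus ℝ (MvPolynomial.vanishingIdeal ℝ Z) = Z ∧
    (MvPolynomial.vanishingIdeal ℝ Z).IsPrime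

/-- `Z` is an irreducible component of `X`: a maximal irreducible Zariski closed subset of `X`. -/
def IsIrreducibleComponent {S : Type*} (X Z : Set (S → ℝ)) : Prop :=
  Maximal (fun Y => Y ⊆ X ∧ IsIrreducibleZariskiClosed Y) Z

/-- `ι(w)` and `ι(w')` lie in the same irreducible component of the Shi variety. -/
def SameComponent {P : RootPairing I ℝ V N} [Finite I] [P.IsCrystallographic] (b : P.Base)
    (w w' : affineWeylGroup P) : Prop :=
  ∃ Z, IsIrreducibleComponent (shiVariety b) Z ∧ shiVector b w ∈ Z ∧ shiVector b w' ∈ Z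

/-- The alcoves `A_w` and `A_{w'}` have the same orientation: `w' = τ_x w` for some `x ∈ ℤΦ`. -/
def SameOrientation (P : RootPairing I ℝ V N) (w w' : affineWeylGroup P) : Prop :=
  ∃ x ∈ P.rootSpan ℤ, (w' : V ≃ᵃ[ℝ] V) = translation x * (w : V ≃ᵃ[ℝ] V)

/-- `P` has Cartan matrix `C = (⟨α_i, α_j^∨⟩)` with respect to the numbering `α` of the simple
roots. -/
def HasCartanMatrix {P : RootPairing I ℝ V N} [P.IsCrystallographic] (b : P.Base) {n : ℕ}
    (α : Fin n ≃ b.support) (C : Matrix (Fin n) (Fin n) ℤ) : Prop :=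
  ∀ i j, b.cartanMatrix (α i) (α j) = C i j

end ShiVariety

/-! On the Shi variety each function `X_θ - P_θ` takes finitely many values, natural numbers below
the height of `θ^∨`. The product of the corresponding factors vanishes on an irreducible component,
so primality of its vanishing ideal makes `X_θ - P_θ` constant there. Hence, within a component, the
difference of two Shi vectors is determined linearly by its simple coordinates
(`shiCoeff_sub_eq_sum`).

Translation by `x` in the root lattice shifts the coefficient at `θ` by `⟨x, θ^∨⟩`. If the simple
coordinates of the difference are the numbers `⟨x, α_j^∨⟩`, then all coordinates match, so `τ_x A_w
= A_{w'}`. Since the affine Weyl group acts freely on alcoves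
(`eq_one_of_apply_mem_fundamentalAlcove`), `w' = τ_x w`. Thus equal orientation means that the
difference at the simple roots lies in the integer row span of the Cartan matrix
(`sameOrientation_iff_exists`).

For the classical types, membership in that span is a second-order recurrence along the Dynkin
diagram. It is solved in closed form by `chainSolution`, and the boundary conditions at the end of
the diagram give the congruences. -/

namespace ShiVariety

variable {I V N : Type*} [AddCommGroup V] [Module ℝ V] [AddCommGroup N] [Module ℝ N]

/-! ### Freeness of the action of the affine Weyl group on alcoves -/

/-- The subgroup of linear automorphisms generated by the reflections. -/
def linearWeylGroup (P : RootPairing I ℝ V N) : Subgroup (V ≃ₗ[ℝ] V) :=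
  Subgroup.closure (Set.range P.reflection)

theorem exists_perm_of_mem_linearWeylGroup {P : RootPairing I ℝ V N} {u : V ≃ₗ[ℝ] V}
    (hu : u ∈ linearWeylGroup P) : ∃ σ : Equiv.Perm I, (∀ i, u (P.root i) = P.root (σ i)) ∧
      ∀ i x, P.coroot' (σ i) (u x) = P.coroot' i x := by
  induction hu using Subgroup.closure_induction with
  | mem u hu =>
    obtain ⟨j, rfl⟩ := hu
    exact ⟨P.reflectionPerm j, fun i => (P.root_reflectionPerm j i).symm,
      fun i x => by
        rw [P.coroot'_reflection, P.reflectionPerm_self]⟩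
  | one => exact ⟨1, fun i => rfl, fun i x => rfl⟩
  | mul u v _ _ hu hv =>
    obtain ⟨σ, hσ, hσ'⟩ := hu
    obtain ⟨τ, hτ, hτ'⟩ := hv
    exact ⟨σ * τ, fun i => by simp [LinearEquiv.mul_apply, hσ, hτ],
      fun i x => by simp [LinearEquiv.mul_apply, hσ', hτ']⟩
  | inv u _ hu =>
    obtain ⟨σ, hσ, hσ'⟩ := hu
    refine ⟨σ⁻¹, fun i => ?_, fun i x => ?_⟩
    · apply u.injective
      rw [hσ]
      change u (u.symm _) = P.root (σ (σ.symm i))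
      simp
    · rw [← hσ']
      change P.coroot' (σ (σ.symm i)) (u (u.symm x)) = _
      simp

/-- The conjugation rule `u s_j u⁻¹ = s_{u(j)}`, in a form convenient for cancelling letters in
words. -/
theorem reflection_mul_of_apply_root_eq {P : RootPairing I ℝ V N} {u : V ≃ₗ[ℝ] V}
    (hu : u ∈ linearWeylGroup P) {i j : I} (h : u (P.root j) = P.root i) :
    P.reflection i * u = u * P.reflection j := by
  obtain ⟨σ, hσ, hσ'⟩ := exists_perm_of_mem_linearWeylGroup hu
  obtain rfl : σ j = i := P.root.injective (by rw [← hσ, h])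
  ext x
  simp [LinearEquiv.mul_apply, RootPairing.reflection_apply, hσ, hσ']

theorem map_mem_rootSpan {P : RootPairing I ℝ V N} {u : V ≃ₗ[ℝ] V}
    (hu : u ∈ linearWeylGroup P) {x : V} (hx : x ∈ P.rootSpan ℤ) : u x ∈ P.rootSpan ℤ := by
  obtain ⟨σ, hσ, -⟩ := exists_perm_of_mem_linearWeylGroup hu
  induction hx using Submodule.span_induction with
  | mem x hx =>
    obtain ⟨i, rfl⟩ := hx
    rw [hσ]
    exact Submodule.subset_span ⟨_, rfl⟩
  | zero => simp
  | add x y _ _ hx hy => rw [map_add]; exact add_mem hx hy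
  | smul a x _ hx => rw [map_zsmul]; exact Submodule.smul_mem _ a hx

/-- Every element of the affine Weyl group is the composition of an element of the Weyl group and
a translation by an element of the root lattice. -/
theorem exists_translation_linear (P : RootPairing I ℝ V N) {g : V ≃ᵃ[ℝ] V}
    (hg : g ∈ affineWeylGroup P) :
    ∃ q ∈ P.rootSpan ℤ, ∃ u ∈ linearWeylGroup P, ∀ x, g x = q + u x := by
  induction hg using Subgroup.closure_induction with
  | mem g hg =>
    obtain ⟨j, k, rfl⟩ := hg
    refine ⟨k • P.root j, Submodule.smul_mem _ _ (Submodule.subset_span ⟨j, rfl⟩),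
      P.reflection j, Subgroup.subset_closure ⟨j, rfl⟩, fun x => ?_⟩
    rw [affineReflection_apply, RootPairing.reflection_apply, sub_smul, Int.cast_smul_eq_zsmul]
    abel
  | one => exact ⟨0, zero_mem _, 1, one_mem _, fun x => by simp⟩
  | mul g h _ _ hg hh =>
    obtain ⟨q, hq, u, hu, hgx⟩ := hg
    obtain ⟨r, hr, v, hv, hhx⟩ := hh
    refine ⟨q + u r, add_mem hq (map_mem_rootSpan hu hr), u * v, mul_mem hu hv, fun x => ?_⟩
    rw [AffineEquiv.coe_mul, Function.comp_apply, hgx, hhx, map_add, LinearEquiv.mul_apply]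
    abel
  | inv g _ hg =>
    obtain ⟨q, hq, u, hu, hgx⟩ := hg
    refine ⟨-(u⁻¹ q), neg_mem (map_mem_rootSpan (inv_mem hu) hq), u⁻¹, inv_mem hu, fun x => ?_⟩
    apply g.injective
    change g (g.symm x) = _
    rw [g.apply_symm_apply, hgx, map_add, map_neg]
    change x = q + (-(u (u.symm q)) + u (u.symm x))
    simp

theorem translation_mem_affineWeylGroup (P : RootPairing I ℝ V N) {x : V}
    (hx : x ∈ P.rootSpan ℤ) : translation x ∈ affineWeylGroup P := by
  have hadd (x y : V) : translation (x + y) = translation x * translation y := by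
    ext z
    simp [translation_apply, add_assoc]
  have hneg (x : V) : translation (-x) = (translation x)⁻¹ := by
    rw [eq_inv_iff_mul_eq_one, ← hadd]
    ext z
    simp [translation_apply]
  induction hx using Submodule.span_induction with
  | mem x hx =>
    obtain ⟨i, rfl⟩ := hx
    have h : translation (P.root i) = affineReflection P i 1 * affineReflection P i 0 := by
      ext z
      simp only [translation_apply, AffineEquiv.coe_mul, Function.comp_apply,
        affineReflection_apply, map_sub, map_smul, RootPairing.root_coroot'_eq_pairing,
        RootPairing.pairing_same, smul_eq_mul, Int.cast_one, Int.cast_zero]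
      module
    rw [h]
    exact mul_mem (Subgroup.subset_closure ⟨i, 1, rfl⟩) (Subgroup.subset_closure ⟨i, 0, rfl⟩)
  | zero =>
    convert one_mem (affineWeylGroup P)
    ext z
    simp [translation_apply]
  | add x y _ _ hx hy => rw [hadd]; exact mul_mem hx hy
  | smul a x _ hx =>
    have hnat (m : ℕ) : translation (m • x) ∈ affineWeylGroup P := by
      induction m with
      | zero =>
        convert one_mem (affineWeylGroup P)
        ext z
        simp [translation_apply]
      | succ m ih => rw [succ_nsmul, hadd]; exact mul_mem ih hx
    obtain ⟨m, rfl | rfl⟩ := a.eq_nat_or_neg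
    · rw [natCast_zsmul]; exact hnat m
    · rw [neg_smul, natCast_zsmul, hneg]; exact inv_mem (hnat m)

/-- Negatives of roots are roots, so integer coefficients can be absorbed into the list; list length
then serves as an induction parameter. -/
theorem exists_list_of_mem_rootSpan (P : RootPairing I ℝ V N) {q : V} (hq : q ∈ P.rootSpan ℤ) :
    ∃ L : List I, (L.map P.root).sum = q := by
  let := P.indexNeg
  induction hq using Submodule.span_induction with
  | mem x hx =>
    obtain ⟨i, rfl⟩ := hx
    exact ⟨[i], by simp⟩
  | zero => exact ⟨[], rfl⟩
  | add x y _ _ hx hy =>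
    obtain ⟨L, rfl⟩ := hx
    obtain ⟨M, rfl⟩ := hy
    exact ⟨L ++ M, by simp⟩
  | smul a x _ hx =>
    obtain ⟨L, rfl⟩ := hx
    have hnat (m : ℕ) : ∃ M : List I, (M.map P.root).sum = m • (L.map P.root).sum := by
      induction m with
      | zero => exact ⟨[], by simp⟩
      | succ m ih =>
        obtain ⟨M, hM⟩ := ih
        exact ⟨M ++ L, by simp [hM, succ_nsmul]⟩
    obtain ⟨m, rfl | rfl⟩ := a.eq_nat_or_neg
    · simpa using hnat m
    · obtain ⟨M, hM⟩ := hnat m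
      refine ⟨M.map (fun i => -i), ?_⟩
      rw [neg_smul, natCast_zsmul, ← hM, List.map_map]
      clear hM
      induction M with
      | nil => simp
      | cons i M ih => simpa [add_comm] using ih

/-- A sum of roots that pairs to at most `1` with every coroot vanishes. -/
theorem sum_root_eq_zero_of_coroot_le_one [Finite I] (P : RootPairing I ℝ V N)
    [P.IsCrystallographic] (L : List I)
    (hL : ∀ i, P.coroot' i (L.map P.root).sum ≤ 1) : (L.map P.root).sum = 0 := by
  classical
  match L with
  | [] => rfl
  | a :: M =>
    -- If a later root pairs negatively with `a^∨`, its sum with the root `a` is zero or a root, and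
    -- the list shortens. Otherwise `a^∨` takes a value at least `2` on the sum.
    by_cases hneg : ∃ c ∈ M, P.pairingIn ℤ c a < 0
    · obtain ⟨c, hc, hca⟩ := hneg
      have hlen := List.length_erase_add_one hc
      have hM : (M.map P.root).sum = P.root c + ((M.erase c).map P.root).sum := by
        rw [((List.perm_cons_erase hc).map P.root).sum_eq]
        simp
      rw [List.map_cons, List.sum_cons, hM, ← add_assoc] at hL ⊢
      by_cases h0 : P.root c = - P.root a
      · have h1 : P.root a + P.root c = 0 := by rw [h0]; simp
        rw [h1, zero_add] at hL ⊢
        exact sum_root_eq_zero_of_coroot_le_one P (M.erase c) hL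
      · obtain ⟨e, he⟩ := P.root_add_root_mem_of_pairingIn_neg hca h0
        have h1 : P.root a + P.root c + ((M.erase c).map P.root).sum
            = ((e :: M.erase c).map P.root).sum := by
          simp [he, add_comm (P.root a)]
        rw [h1] at hL ⊢
        exact sum_root_eq_zero_of_coroot_le_one P (e :: M.erase c) hL
    · push Not at hneg
      have h1 := hL a
      have h2 : 0 ≤ P.coroot' a (M.map P.root).sum := by
        rw [map_list_sum, List.map_map]
        refine List.sum_nonneg fun x hx => ?_
        obtain ⟨c, hc, rfl⟩ := List.mem_map.1 hx
        have := hneg c hc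
        rw [Function.comp_apply, RootPairing.root_coroot'_eq_pairing,
          ← P.algebraMap_pairingIn ℤ]
        exact Int.cast_nonneg this
      rw [List.map_cons, List.sum_cons, map_add, RootPairing.root_coroot'_eq_pairing,
        RootPairing.pairing_same] at h1
      linarith
termination_by L.length
decreasing_by all_goals (simp only [List.length_cons]; omega)

/-! ### Words in simple reflections and freeness on alcoves -/

section Base

variable {P : RootPairing I ℝ V N} (b : P.Base)

variable [Finite I] [P.IsCrystallographic] [P.IsReduced]

theorem reflection_mem_closure_simple (i : I) :
    P.reflection i ∈ Subgroup.closure (P.reflection '' b.support) := by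
  refine b.induction_reflect i (p := fun i => P.reflection i ∈
    Subgroup.closure (P.reflection '' b.support)) (fun i hi => ?_)
    (fun i hi => Subgroup.subset_closure ⟨i, hi, rfl⟩) (fun i j hi hj => ?_)
  · rw [RootPairing.reflection_reflectionPerm]
    exact mul_mem (mul_mem hi hi) hi
  · rw [RootPairing.reflection_reflectionPerm]
    have h := Subgroup.subset_closure (k := P.reflection '' b.support) ⟨j, hj, rfl⟩
    exact mul_mem (mul_mem h hi) h

theorem exists_list_of_mem_linearWeylGroup {u : V ≃ₗ[ℝ] V} (hu : u ∈ linearWeylGroup P) :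
    ∃ L : List I, (∀ i ∈ L, i ∈ b.support) ∧ (L.map P.reflection).prod = u := by
  have hu' : u ∈ Subgroup.closure (P.reflection '' b.support) := by
    refine (Subgroup.closure_le _).2 ?_ hu
    rintro _ ⟨i, rfl⟩
    exact reflection_mem_closure_simple b i
  clear hu
  induction hu' using Subgroup.closure_induction with
  | mem u hu =>
    obtain ⟨i, hi, rfl⟩ := hu
    exact ⟨[i], by simpa using hi, by simp⟩
  | one => exact ⟨[], by simp, rfl⟩
  | mul u v _ _ hu hv =>
    obtain ⟨L, hL, rfl⟩ := hu
    obtain ⟨M, hM, rfl⟩ := hv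
    exact ⟨L ++ M, by grind, by simp⟩
  | inv u _ hu =>
    obtain ⟨L, hL, rfl⟩ := hu
    refine ⟨L.reverse, by simpa using hL, ?_⟩
    rw [List.prod_inv_reverse, List.map_reverse, List.map_map]
    congr 3

/-- The exchange property. -/
theorem exists_list_mul_reflection (L : List I) (hL : ∀ i ∈ L, i ∈ b.support) {j k : I}
    (hj : b.IsPos j) (hk : ¬ b.IsPos k) (hjk : (L.map P.reflection).prod (P.root j) = P.root k) :
    ∃ M : List I, (∀ i ∈ M, i ∈ b.support) ∧ M.length + 1 = L.length ∧
      (M.map P.reflection).prod = (L.map P.reflection).prod * P.reflection j := by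
  induction L generalizing k with
  | nil =>
    have : j = k := P.root.injective (by simpa using hjk)
    exact absurd (this ▸ hj) hk
  | cons i L ih =>
    simp only [List.mem_cons, forall_eq_or_imp] at hL
    set v := (L.map P.reflection).prod with hv
    have hvj : v (P.root j) = P.root (P.reflectionPerm i k) := by
      apply (P.reflection i).injective
      rw [List.map_cons, List.prod_cons, LinearEquiv.mul_apply] at hjk
      rw [hjk, P.root_reflectionPerm, ← LinearEquiv.mul_apply, ← sq, P.reflection_sq]
      rfl
    -- A simple reflection `s_i` permutes the positive roots other than `i`. Since `k` is not
    -- positive but `s_i k` is, `s_i k = i`; then `s_i v = v s_j`, and `s_j` cancels. Otherwise the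
    -- sign change already occurs in the tail `v`.
    by_cases hp : b.IsPos (P.reflectionPerm i k)
    · have hik : P.reflectionPerm i k = i := by
        by_contra hne
        exact hk (by simpa using hp.reflectionPerm hL.1 hne)
      rw [hik] at hvj
      refine ⟨L, hL.2, by simp, ?_⟩
      have hvmem : v ∈ linearWeylGroup P := by
        refine list_prod_mem fun x hx => ?_
        obtain ⟨l, -, rfl⟩ := List.mem_map.1 hx
        exact Subgroup.subset_closure ⟨l, rfl⟩
      rw [List.map_cons, List.prod_cons, ← hv, reflection_mul_of_apply_root_eq hvmem hvj, mul_assoc,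
        ← sq, P.reflection_sq, mul_one]
    · obtain ⟨M, hM, hlen, hprod⟩ := ih hL.2 hp hvj
      refine ⟨i :: M, by simpa using ⟨hL.1, hM⟩, by simp [← hlen], ?_⟩
      rw [List.map_cons, List.prod_cons, hprod, List.map_cons, List.prod_cons, mul_assoc]

/-- Induction on word length: if the word ends in `s_j`, positivity of the image of `α_j` makes the
preceding word send `α_j` to a negative root, and the exchange property yields a shorter word for
the same element. -/
theorem eq_one_of_forall_isPos (L : List I) (hL : ∀ i ∈ L, i ∈ b.support)
    (hpos : ∀ i k, b.IsPos i → (L.map P.reflection).prod (P.root i) = P.root k → b.IsPos k) :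
    (L.map P.reflection).prod = 1 := by
  let := P.indexNeg
  rcases L.eq_nil_or_concat with rfl | ⟨L', j, rfl⟩
  · rfl
  · simp only [List.concat_eq_append, List.mem_append, List.mem_singleton] at hL
    have hjs : j ∈ b.support := hL j (Or.inr rfl)
    have hj : b.IsPos j := b.isPos_of_mem_support hjs
    set v := (L'.map P.reflection).prod with hv
    have hprod : ((L'.concat j).map P.reflection).prod = v * P.reflection j := by simp [hv]
    rw [hprod] at hpos ⊢
    have hvmem : v ∈ linearWeylGroup P := by
      refine list_prod_mem fun x hx => ?_
      obtain ⟨l, -, rfl⟩ := List.mem_map.1 hx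
      exact Subgroup.subset_closure ⟨l, rfl⟩
    obtain ⟨σ, hσ, -⟩ := exists_perm_of_mem_linearWeylGroup hvmem
    have hneg : ¬ b.IsPos (σ j) := by
      rw [← RootPairing.Base.IsPos.neg_iff_not]
      refine hpos j _ hj ?_
      simp [LinearEquiv.mul_apply, hσ]
    obtain ⟨M, hM, hlen, hMprod⟩ :=
      exists_list_mul_reflection b L' (fun i hi => hL i (Or.inl hi)) hj hneg (hσ j)
    rw [← hMprod] at hpos ⊢
    exact eq_one_of_forall_isPos M hM hpos
termination_by L.length
decreasing_by grind

/-- The affine Weyl group acts freely on the alcoves. -/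
theorem eq_one_of_apply_mem_fundamentalAlcove {g : V ≃ᵃ[ℝ] V} (hg : g ∈ affineWeylGroup P) {y : V}
    (hy : y ∈ fundamentalAlcove b) (hgy : g y ∈ fundamentalAlcove b) : g = 1 := by
  let := P.indexNeg
  obtain ⟨q, hq, u, hu, hgu⟩ := exists_translation_linear P hg
  obtain ⟨σ, hσ, hσ'⟩ := exists_perm_of_mem_linearWeylGroup hu
  rw [mem_fundamentalAlcove] at hy hgy
  have habs {z : V} (hz : ∀ i, b.IsPos i → 0 < P.coroot' i z ∧ P.coroot' i z < 1) (i : I) :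
      -1 < P.coroot' i z ∧ P.coroot' i z < 1 := by
    rcases RootPairing.Base.IsPos.or_neg b i with hi | hi
    · have := hz i hi
      constructor <;> linarith
    · have := hz _ hi
      simp only [RootPairing.coroot', RootPairing.indexNeg_neg, RootPairing.coroot_reflectionPerm,
        RootPairing.coreflection_apply_self, map_neg, LinearMap.neg_apply] at this ⊢
      constructor <;> linarith
  -- Here `q = g y - u y`, and every coroot takes values in `(-1, 1)` at both points. So `⟨q, α^∨⟩`
  -- is an integer less than `2` for every root.
  have hq0 : q = 0 := by
    have hint (i : I) : ∃ m : ℤ, P.coroot' i q = m := by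
      clear hgu
      induction hq using Submodule.span_induction with
      | mem x hx =>
        obtain ⟨j, rfl⟩ := hx
        exact ⟨P.pairingIn ℤ j i, by
          rw [RootPairing.root_coroot'_eq_pairing, ← P.algebraMap_pairingIn ℤ]; rfl⟩
      | zero => exact ⟨0, by simp⟩
      | add x y _ _ hx hy =>
        obtain ⟨m, hm⟩ := hx
        obtain ⟨l, hl⟩ := hy
        exact ⟨m + l, by rw [map_add, hm, hl]; push_cast; rfl⟩
      | smul a x _ hx =>
        obtain ⟨m, hm⟩ := hx
        exact ⟨a * m, by rw [map_zsmul, hm, zsmul_eq_mul]; push_cast; rfl⟩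
    obtain ⟨L, rfl⟩ := exists_list_of_mem_rootSpan P hq
    refine sum_root_eq_zero_of_coroot_le_one P L fun i => ?_
    obtain ⟨m, hm⟩ := hint i
    have h1 := habs hgy i
    obtain ⟨j, rfl⟩ := σ.surjective i
    rw [hgu, map_add, hσ', hm] at h1
    have h2 := habs hy j
    have h3 : (m : ℝ) < 2 := by linarith
    rw [hm]
    have h4 : m < 2 := by exact_mod_cast h3
    exact_mod_cast (by omega : m ≤ 1)
  -- With `q = 0`, a positive root sent to a negative one would give a coroot value of both signs.
  have hu1 : u = 1 := by
    obtain ⟨L, hL, rfl⟩ := exists_list_of_mem_linearWeylGroup b hu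
    refine eq_one_of_forall_isPos b L hL fun i k hi hk => ?_
    obtain rfl : σ i = k := P.root.injective (by rw [← hσ, hk])
    by_contra hneg
    rw [← RootPairing.Base.IsPos.neg_iff_not] at hneg
    have h1 := (hgy _ hneg).1
    have h2 := (hy _ hi).1
    rw [hgu, hq0, zero_add] at h1
    simp only [RootPairing.coroot', RootPairing.indexNeg_neg, RootPairing.coroot_reflectionPerm,
      RootPairing.coreflection_apply_self, map_neg, LinearMap.neg_apply] at h1
    have h3 := hσ' i y
    simp only [RootPairing.coroot'] at h2 h3
    linarith
  ext x
  rw [hgu, hq0, hu1]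
  simp

end Base
end ShiVariety

namespace ShiVariety

variable {I V N : Type*} [AddCommGroup V] [Module ℝ V] [AddCommGroup N] [Module ℝ N]

section Base

variable {P : RootPairing I ℝ V N} (b : P.Base)

/-! ### Components of the Shi variety and orientation of alcoves -/

theorem aeval_rootPolynomial (θ : PosRoot b) (x : PosRoot b → ℝ) :
    MvPolynomial.aeval x (rootPolynomial b θ)
      = ∑ i : b.support, (corootCoeff b θ i : ℝ) * x (simpleRoot b i) := by
  simp [rootPolynomial]

/-- The admissibility bound leaves finitely many values, independent of the subspace containing `x`;
this permits a finite product of polynomials below. -/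
theorem exists_nat_of_mem_shiVariety [Finite I] {x : PosRoot b → ℝ} (hx : x ∈ shiVariety b)
    (θ : PosRoot b) : ∃ m : ℕ, m < (b.flip.height θ).toNat ∧
      x θ - ∑ i : b.support, (corootCoeff b θ i : ℝ) * x (simpleRoot b i) = m := by
  simp only [shiVariety, Set.mem_iUnion] at hx
  obtain ⟨l, hl, hx⟩ := hx
  refine ⟨l θ, by have := hl.1 θ; omega, ?_⟩
  have h := hx _ (Ideal.subset_span ⟨θ, rfl⟩)
  simp only [map_add, map_sub, aeval_rootPolynomial, map_natCast, MvPolynomial.aeval_X] at h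
  linarith

/-- On an irreducible component of the Shi variety, the Shi coefficients at all positive roots
differ from the linear combinations of those at simple roots by constants. -/
theorem shiCoeff_sub_eq_sum [Finite I] [P.IsCrystallographic] {w w' : affineWeylGroup P}
    (h : SameComponent b w w') (θ : PosRoot b) :
    shiCoeff b w' θ - shiCoeff b w θ = ∑ i : b.support, corootCoeff b θ i *
      (shiCoeff b w' (simpleRoot b i) - shiCoeff b w (simpleRoot b i)) := by
  classical
  obtain ⟨Z, hZ, hw, hw'⟩ := h
  obtain ⟨hsub, -, hprime⟩ := hZ.prop
  -- One factor for each possible value of `X_θ - P_θ`; primality then puts a single factor in the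
  -- ideal, which fixes that value on all of `Z`.
  have hmem : ∏ m ∈ Finset.range (b.flip.height θ).toNat,
      (MvPolynomial.X θ - rootPolynomial b θ - (m : MvPolynomial (PosRoot b) ℝ))
        ∈ MvPolynomial.vanishingIdeal ℝ Z := by
    intro x hx
    obtain ⟨m, hm, hxm⟩ := exists_nat_of_mem_shiVariety b (hsub hx) θ
    rw [map_prod]
    refine Finset.prod_eq_zero (Finset.mem_range.2 hm) ?_
    simp only [map_sub, aeval_rootPolynomial, map_natCast, MvPolynomial.aeval_X]
    linarith
  obtain ⟨m, -, hm⟩ := hprime.prod_mem_iff.1 hmem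
  have h1 := hm _ hw
  have h2 := hm _ hw'
  simp only [map_sub, aeval_rootPolynomial, map_natCast, MvPolynomial.aeval_X, shiVector] at h1 h2
  rw [← Int.cast_inj (α := ℝ)]
  push_cast
  simp only [mul_sub, Finset.sum_sub_distrib]
  linarith

/-- An integer shift carries one open unit strip onto another, so a single pair of points determines
the difference of coefficients. -/
theorem shiCoeff_eq_of_mem_alcove [Finite I] [P.IsCrystallographic] {w w' : affineWeylGroup P}
    {x y : V} (hy : y ∈ alcove b w) (hxy : x + y ∈ alcove b w') {θ : PosRoot b} {m : ℤ}
    (hm : P.coroot' θ x = m) : shiCoeff b w' θ - shiCoeff b w θ = m := by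
  rw [alcove_eq_iInter_strip, Set.mem_iInter] at hy hxy
  have h1 := hy θ
  have h2 := hxy θ
  simp only [strip, Set.mem_ofPred_eq, map_add, hm] at h1 h2
  have h3 : (shiCoeff b w θ : ℝ) + m < shiCoeff b w' θ + 1 := by linarith
  have h4 : (shiCoeff b w' θ : ℝ) < shiCoeff b w θ + 1 + m := by linarith
  norm_cast at h3 h4
  omega

theorem coroot'_sum_zsmul [P.IsCrystallographic] (m : b.support → ℤ) (j : b.support) :
    P.coroot' j (∑ i, m i • P.root i) = ((∑ i, m i * b.cartanMatrix i j : ℤ) : ℝ) := by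
  rw [map_sum]
  push_cast
  refine Finset.sum_congr rfl fun i _ => ?_
  rw [map_zsmul, RootPairing.root_coroot'_eq_pairing, ← P.algebraMap_pairingIn ℤ, zsmul_eq_mul]
  rfl

theorem sameOrientation_iff_exists [Finite I] [P.IsCrystallographic] [P.IsReduced]
    {w w' : affineWeylGroup P} (h : SameComponent b w w') :
    SameOrientation P w w' ↔ ∃ m : b.support → ℤ, ∀ j,
      shiCoeff b w' (simpleRoot b j) - shiCoeff b w (simpleRoot b j)
        = ∑ i, m i * b.cartanMatrix i j := by
  obtain ⟨y, hy⟩ := fundamentalAlcove_nonempty b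
  constructor
  · rintro ⟨x, hx, hw'⟩
    refine ⟨fun i => b.toWeightBasisInt.repr ⟨x, hx⟩ i, fun j => ?_⟩
    refine shiCoeff_eq_of_mem_alcove b (x := x) (y := (w : V ≃ᵃ[ℝ] V) y) ⟨y, hy, rfl⟩
      ⟨y, hy, by rw [hw']; rfl⟩ ?_
    have hsum := congrArg (fun x : P.rootSpan ℤ => (x : V))
      (b.toWeightBasisInt.sum_repr ⟨x, hx⟩)
    simp only [Submodule.coe_sum, Submodule.coe_smul,
      RootPairing.Base.coe_toWeightBasisInt_apply] at hsum
    rw [← coroot'_sum_zsmul b, hsum]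
    rfl
  · rintro ⟨m, hm⟩
    set x := ∑ i, m i • P.root i with hxdef
    have hx : x ∈ P.rootSpan ℤ :=
      sum_mem fun i _ => Submodule.smul_mem _ _ (Submodule.subset_span ⟨_, rfl⟩)
    -- The only use of the common component: agreement at simple roots propagates linearly to every
    -- positive root.
    have hxθ (θ : PosRoot b) : P.coroot' θ x = (shiCoeff b w' θ - shiCoeff b w θ : ℤ) := by
      have hθ : P.coroot' θ x = ∑ i : b.support, corootCoeff b θ i • P.coroot' i x := by
        simp only [RootPairing.coroot']
        rw [coroot_eq_sum_corootCoeff b θ]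
        simp
      rw [shiCoeff_sub_eq_sum b h, hθ]
      push_cast
      refine Finset.sum_congr rfl fun i _ => ?_
      rw [coroot'_sum_zsmul b, ← hm i, zsmul_eq_mul]
      push_cast
      rfl
    refine ⟨x, hx, ?_⟩
    obtain ⟨z, hz, hwz⟩ : (w' : V ≃ᵃ[ℝ] V) y - x ∈ alcove b w := by
      have hmem : (w' : V ≃ᵃ[ℝ] V) y ∈ alcove b w' := ⟨y, hy, rfl⟩
      rw [alcove_eq_iInter_strip, Set.mem_iInter] at hmem ⊢
      intro θ
      have := hmem θ
      simp only [strip, Set.mem_ofPred_eq, map_sub, hxθ] at this ⊢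
      push_cast
      constructor <;> linarith
    -- This element sends `y` to `z`, both in the fundamental alcove, so freeness applies.
    have hone : (w : V ≃ᵃ[ℝ] V)⁻¹ * (translation x)⁻¹ * w' = 1 := by
      refine eq_one_of_apply_mem_fundamentalAlcove b (mul_mem (mul_mem (inv_mem w.2)
        (inv_mem (translation_mem_affineWeylGroup P hx))) w'.2) hy ?_
      convert hz
      rw [mul_assoc]
      change (w : V ≃ᵃ[ℝ] V).symm ((translation x).symm ((w' : V ≃ᵃ[ℝ] V) y)) = z
      rw [AffineEquiv.symm_apply_eq, AffineEquiv.symm_apply_eq, hwz, translation_apply]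
      abel
    rw [mul_assoc, inv_mul_eq_one, eq_inv_mul_iff_mul_eq] at hone
    exact hone.symm

/-- The orientation criterion in terms of a numbering of the simple roots. -/
theorem sameOrientation_iff_of_hasCartanMatrix [Finite I] [P.IsCrystallographic] [P.IsReduced]
    {w w' : affineWeylGroup P} (h : SameComponent b w w') {n : ℕ} (α : Fin n ≃ b.support)
    {C : Matrix (Fin n) (Fin n) ℤ} (hC : HasCartanMatrix b α C) :
    SameOrientation P w w' ↔ ∃ m : Fin n → ℤ, ∀ j,
      shiCoeff b w' (simpleRoot b (α j)) - shiCoeff b w (simpleRoot b (α j))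
        = ∑ i, m i * C i j := by
  rw [sameOrientation_iff_exists b h]
  constructor
  · rintro ⟨m, hm⟩
    refine ⟨m ∘ α, fun j => ?_⟩
    rw [hm, ← α.sum_comp]
    exact Finset.sum_congr rfl fun i _ => by rw [hC]; rfl
  · rintro ⟨m, hm⟩
    refine ⟨m ∘ α.symm, fun j => ?_⟩
    obtain ⟨j, rfl⟩ := α.surjective j
    rw [hm, ← α.sum_comp]
    exact Finset.sum_congr rfl fun i _ => by rw [hC]; simp

end Base
end ShiVariety

namespace ShiVariety

/-! ### Integer row spans of the Cartan matrices of classical type -/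

/-- The solution with `M 0 = 0` and `M 1 = s` of the recurrence
`M (j + 2) = 2 * M (j + 1) - M j - d j`. -/
def chainSolution (d : ℕ → ℤ) (s : ℤ) (j : ℕ) : ℤ :=
  j * (s - ∑ i ∈ Finset.range j, d i) + ∑ i ∈ Finset.range j, ((i : ℤ) + 1) * d i

theorem chainSolution_zero (d : ℕ → ℤ) (s : ℤ) : chainSolution d s 0 = 0 := by
  simp [chainSolution]

/-- The increments start at `s` and drop by `d j` at each step; boundary conditions are read off
from them. -/
theorem chainSolution_succ (d : ℕ → ℤ) (s : ℤ) (j : ℕ) : chainSolution d s (j + 1)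
    = chainSolution d s j + (s - ∑ i ∈ Finset.range j, d i) := by
  simp only [chainSolution, Finset.sum_range_succ]
  push_cast
  ring

theorem chainSolution_add_two (d : ℕ → ℤ) (s : ℤ) (j : ℕ) : chainSolution d s (j + 2)
    = 2 * chainSolution d s (j + 1) - chainSolution d s j - d j := by
  rw [chainSolution_succ d s (j + 1), chainSolution_succ d s j, Finset.sum_range_succ]
  ring

theorem eq_chainSolution {d M : ℕ → ℤ} (h0 : M 0 = 0) {t : ℕ}
    (h : ∀ j < t, d j = 2 * M (j + 1) - M j - M (j + 2)) {j : ℕ} (hj : j ≤ t + 1) :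
    M j = chainSolution d (M 1) j := by
  induction j using Nat.strong_induction_on with
  | _ j ih =>
    match j with
    | 0 => rw [h0, chainSolution_zero]
    | 1 => simp [chainSolution_succ, chainSolution_zero]
    | j + 2 =>
      rw [chainSolution_add_two, ← ih (j + 1) (by omega) (by omega), ← ih j (by omega) (by omega)]
      linarith [h j (by omega)]

/-- Cartan columns are written as sums of indicators, with `p` carrying boundary conditions. The
shift `i + 1` leaves index `0` for the boundary value `M 0 = 0`. -/
theorem sum_mul_ite_val_eq {n : ℕ} (M : ℕ → ℤ) (a : ℕ) (p : Prop) [Decidable p] :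
    ∑ i : Fin n, M (i + 1) * (if (i : ℕ) = a ∧ p then 1 else 0)
      = if a < n ∧ p then M (a + 1) else 0 := by
  rw [Fin.sum_univ_eq_sum_range (fun i => M (i + 1) * (if i = a ∧ p then 1 else 0))]
  by_cases hp : p <;> simp [hp]

theorem sum_mul_cartanMatrix_A {n : ℕ} {M : ℕ → ℤ} (h0 : M 0 = 0) (j : Fin n) :
    ∑ i : Fin n, M (i + 1) * CartanMatrix.A n i j
      = 2 * M (j + 1) - M j - (if (j : ℕ) + 1 < n then M (j + 2) else 0) := by
  obtain ⟨j, hj⟩ := j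
  -- The guard `1 ≤ j` is needed because `j - 1` truncates to `0` at `j = 0`.
  have hA (i : Fin n) : CartanMatrix.A n i ⟨j, hj⟩ = 2 * (if (i : ℕ) = j ∧ True then 1 else 0)
      - (if (i : ℕ) = j - 1 ∧ 1 ≤ j then 1 else 0) - (if (i : ℕ) = j + 1 ∧ True then 1 else 0) := by
    simp only [CartanMatrix.A, Matrix.of_apply, Fin.ext_iff]
    grind
  simp only [hA, mul_sub, mul_left_comm _ (2 : ℤ), Finset.sum_sub_distrib, ← Finset.mul_sum,
    sum_mul_ite_val_eq]
  rcases j with _ | j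
  · simp [h0, hj]
  · simp [hj, show j < n by omega]

/-- A sequence `M` with `M 0 = 0` extending a vector `m`, shifted by one. -/
theorem exists_extension {n : ℕ} (m : Fin n → ℤ) :
    ∃ M : ℕ → ℤ, M 0 = 0 ∧ (∀ i : Fin n, M (i + 1) = m i) ∧ ∀ i, n < i → M i = 0 := by
  refine ⟨fun i => if h : 1 ≤ i ∧ i ≤ n then m ⟨i - 1, by omega⟩ else 0, by simp, fun i => ?_,
    fun i hi => ?_⟩
  · simp
  · simp only [dite_eq_right_iff]
    intro h
    omega

theorem exists_row_iff {n : ℕ} (C : Matrix (Fin n) (Fin n) ℤ) (d : ℕ → ℤ) :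
    (∃ m : Fin n → ℤ, ∀ j : Fin n, d j = ∑ i, m i * C i j) ↔
      ∃ M : ℕ → ℤ, M 0 = 0 ∧ ∀ j : Fin n, d j = ∑ i : Fin n, M (i + 1) * C i j := by
  constructor
  · rintro ⟨m, hm⟩
    obtain ⟨M, h0, hM, -⟩ := exists_extension m
    exact ⟨M, h0, fun j => by simp only [hM, hm]⟩
  · rintro ⟨M, -, hM⟩
    exact ⟨fun i => M (i + 1), hM⟩

/-- The chain has boundary values `M 0 = M (n + 1) = 0`. The second one reads `(n + 1) (s - ∑ d) + ∑
(j + 1) d_j = 0`, solvable in `s` exactly under the divisibility. -/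
theorem exists_row_A_iff (n : ℕ) (d : ℕ → ℤ) :
    (∃ m : Fin n → ℤ, ∀ j : Fin n, d j = ∑ i, m i * CartanMatrix.A n i j) ↔
      ((n : ℤ) + 1) ∣ ∑ j ∈ Finset.range n, ((j : ℤ) + 1) * d j := by
  constructor
  · rintro ⟨m, hm⟩
    obtain ⟨M, h0, hM, hM'⟩ := exists_extension m
    simp only [← hM, sum_mul_cartanMatrix_A h0] at hm
    have hrec (j : ℕ) (hj : j < n) : d j = 2 * M (j + 1) - M j - M (j + 2) := by
      rw [hm ⟨j, hj⟩]
      split_ifs with h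
      · rfl
      · rw [hM' (j + 2) (by simp at h; omega)]
    have h1 := eq_chainSolution h0 hrec le_rfl
    rw [hM' _ (Nat.lt_succ_self n), chainSolution_succ, chainSolution] at h1
    exact ⟨∑ i ∈ Finset.range n, d i - M 1, by linarith⟩
  · rintro ⟨t, ht⟩
    rw [exists_row_iff]
    refine ⟨chainSolution d (∑ i ∈ Finset.range n, d i - t), chainSolution_zero _ _, fun j => ?_⟩
    rw [sum_mul_cartanMatrix_A (chainSolution_zero _ _)]
    have h := chainSolution_add_two d (∑ i ∈ Finset.range n, d i - t) j
    split_ifs with hj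
    · linarith
    · have hjn : (j : ℕ) + 1 = n := by omega
      have hz : chainSolution d (∑ i ∈ Finset.range n, d i - t) (j + 2) = 0 := by
        rw [show (j : ℕ) + 2 = n + 1 by omega, chainSolution_succ, chainSolution, ht]
        ring
      linarith

theorem sum_mul_cartanMatrix_B {n : ℕ} {M : ℕ → ℤ} (h0 : M 0 = 0) (j : Fin n) :
    ∑ i : Fin n, M (i + 1) * CartanMatrix.B n i j
      = 2 * M (j + 1) - M j - (if (j : ℕ) + 1 < n then M (j + 2) else M j) := by
  have hB (i : Fin n) : CartanMatrix.B n i j = CartanMatrix.A n i j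
      - (if (i : ℕ) = j - 1 ∧ (1 ≤ (j : ℕ) ∧ (j : ℕ) + 1 = n) then 1 else 0) := by
    simp only [CartanMatrix.A, CartanMatrix.B, Matrix.of_apply, Fin.ext_iff]
    grind
  simp only [hB, mul_sub, Finset.sum_sub_distrib, sum_mul_ite_val_eq, sum_mul_cartanMatrix_A h0]
  obtain ⟨j, hj⟩ := j
  rcases j with _ | j
  · simp [h0]
  · by_cases h : j + 1 + 1 = n
    · simp [← h]
    · simp [h, show j + 1 + 1 < n by omega]

/-- Only the last column obstructs: it equals twice the last increment, and `s` can make that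
increment any integer. -/
theorem exists_row_B_iff (p : ℕ) (d : ℕ → ℤ) :
    (∃ m : Fin (p + 1) → ℤ, ∀ j : Fin (p + 1), d j = ∑ i, m i * CartanMatrix.B (p + 1) i j) ↔
      2 ∣ d p := by
  rw [exists_row_iff]
  constructor
  · rintro ⟨M, h0, hM⟩
    have h := hM (Fin.last p)
    rw [sum_mul_cartanMatrix_B h0] at h
    simp only [Fin.val_last, lt_self_iff_false, if_false] at h
    exact ⟨M (p + 1) - M p, by linarith⟩
  · rintro ⟨t, ht⟩
    refine ⟨chainSolution d (∑ i ∈ Finset.range p, d i + t), chainSolution_zero _ _, fun j => ?_⟩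
    rw [sum_mul_cartanMatrix_B (chainSolution_zero _ _)]
    have h := chainSolution_add_two d (∑ i ∈ Finset.range p, d i + t) j
    split_ifs with hj
    · linarith
    · rw [show (j : ℕ) = p by omega, chainSolution_succ, ht]
      ring

theorem sum_mul_cartanMatrix_C {n : ℕ} {M : ℕ → ℤ} (h0 : M 0 = 0) (j : Fin n) :
    ∑ i : Fin n, M (i + 1) * CartanMatrix.C n i j
      = 2 * M (j + 1) - M j - (if (j : ℕ) + 1 < n then M (j + 2) else 0)
        - (if (j : ℕ) + 2 = n then M (j + 2) else 0) := by
  have hC (i : Fin n) : CartanMatrix.C n i j = CartanMatrix.A n i j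
      - (if (i : ℕ) = j + 1 ∧ (j : ℕ) + 2 = n then 1 else 0) := by
    simp only [CartanMatrix.A, CartanMatrix.C, Matrix.of_apply, Fin.ext_iff]
    grind
  simp only [hC, mul_sub, Finset.sum_sub_distrib, sum_mul_ite_val_eq, sum_mul_cartanMatrix_A h0]
  grind

theorem exists_row_C_iff (p : ℕ) (d : ℕ → ℤ) :
    (∃ m : Fin (p + 2) → ℤ, ∀ j : Fin (p + 2), d j = ∑ i, m i * CartanMatrix.C (p + 2) i j) ↔
      2 ∣ ∑ j ∈ Finset.range (p + 2), ((j : ℤ) + 1) * d j := by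
  rw [exists_row_iff]
  constructor
  · rintro ⟨M, h0, hM⟩
    simp only [sum_mul_cartanMatrix_C h0] at hM
    -- Doubling the last coordinate turns the system into a plain chain with `M' (p + 3) = M' (p +
    -- 2)`. The vanishing increment forces `s = ∑ d`, and the weighted sum becomes `M' (p + 2)`,
    -- which is even.
    let M' : ℕ → ℤ := fun i => if i ≤ p + 1 then M i else 2 * M (p + 2)
    have hrec (j : ℕ) (hj : j < p + 2) : d j = 2 * M' (j + 1) - M' j - M' (j + 2) := by
      have := hM ⟨j, hj⟩
      grind
    have hM0 : M' 0 = 0 := by simp [M', h0]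
    have h1 := eq_chainSolution hM0 hrec (j := p + 3) (by omega)
    have h2 := eq_chainSolution hM0 hrec (j := p + 2) (by omega)
    have h3 : M' (p + 3) = M' (p + 2) := by simp [M']
    rw [chainSolution_succ, ← h2, h3] at h1
    have h4 : M' 1 - ∑ i ∈ Finset.range (p + 2), d i = 0 := by linarith
    rw [chainSolution, h4, mul_zero, zero_add] at h2
    exact ⟨M (p + 2), by rw [← h2]; simp [M']⟩
  · rintro ⟨t, ht⟩
    set s := ∑ i ∈ Finset.range (p + 2), d i with hs
    have hlast : chainSolution d s (p + 2) = 2 * t := by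
      rw [chainSolution, ← hs, ht]
      ring
    have hlast' : chainSolution d s (p + 3) = 2 * t := by
      rw [chainSolution_succ, ← hs, hlast]
      ring
    obtain ⟨M, hM⟩ : ∃ M : ℕ → ℤ, ∀ i, M i = if i ≤ p + 1 then chainSolution d s i else t :=
      ⟨_, fun _ => rfl⟩
    have h0 : M 0 = 0 := by simp [hM, chainSolution_zero]
    refine ⟨M, h0, fun j => ?_⟩
    rw [sum_mul_cartanMatrix_C h0]
    simp only [hM]
    have h := chainSolution_add_two d s j
    obtain ⟨j, hj⟩ := j
    rcases (by omega : j < p ∨ j = p ∨ j = p + 1) with hjp | rfl | rfl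
    · simp only [show j + 1 ≤ p + 1 by omega, show j ≤ p + 1 by omega, show j + 2 ≤ p + 1 by omega,
        show j + 1 < p + 2 by omega, show ¬ j + 2 = p + 2 by omega, if_true, if_false]
      linarith
    · simp
      linarith
    · simp
      linarith

theorem sum_mul_cartanMatrix_D {p : ℕ} {M : ℕ → ℤ} (h0 : M 0 = 0) (j : Fin (p + 3)) :
    ∑ i : Fin (p + 3), M (i + 1) * CartanMatrix.D (p + 3) i j
      = if (j : ℕ) < p then 2 * M (j + 1) - M j - M (j + 2)
        else if (j : ℕ) = p then 2 * M (p + 1) - M p - M (p + 2) - M (p + 3)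
        else 2 * M (j + 1) - M (p + 1) := by
  -- The type `A` chain with its last bond moved: node `p + 2` is detached from `p + 1` and attached
  -- to `p`.
  have hD (i : Fin (p + 3)) : CartanMatrix.D (p + 3) i j = CartanMatrix.A (p + 3) i j
      + (if (i : ℕ) = p + 1 ∧ (j : ℕ) = p + 2 then 1 else 0)
      + (if (i : ℕ) = p + 2 ∧ (j : ℕ) = p + 1 then 1 else 0)
      - (if (i : ℕ) = p ∧ (j : ℕ) = p + 2 then 1 else 0)
      - (if (i : ℕ) = p + 2 ∧ (j : ℕ) = p then 1 else 0) := by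
    simp only [CartanMatrix.A, CartanMatrix.D, Matrix.of_apply, Fin.ext_iff]
    grind (splits := 20)
  simp only [hD, mul_sub, mul_add, Finset.sum_sub_distrib, Finset.sum_add_distrib,
    sum_mul_ite_val_eq, sum_mul_cartanMatrix_A h0]
  grind

theorem exists_row_D_iff (p : ℕ) (d : ℕ → ℤ) :
    (∃ m : Fin (p + 3) → ℤ, ∀ j : Fin (p + 3), d j = ∑ i, m i * CartanMatrix.D (p + 3) i j) ↔
      2 ∣ d (p + 1) - d (p + 2) ∧
      4 ∣ 2 * ∑ j ∈ Finset.range (p + 1), ((j : ℤ) + 1) * d j + (p + 3) * d (p + 1)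
        + (p + 1) * d (p + 2) ∧
      4 ∣ 2 * ∑ j ∈ Finset.range (p + 1), ((j : ℤ) + 1) * d j + (p + 1) * d (p + 1)
        + (p + 3) * d (p + 2) := by
  rw [exists_row_iff]
  constructor
  · rintro ⟨M, h0, hM⟩
    simp only [sum_mul_cartanMatrix_D h0] at hM
    -- Adding the two fork coordinates makes the branch node an ordinary chain node; the fork
    -- columns are kept as `h3` and `h4`.
    let M' : ℕ → ℤ := fun i => if i ≤ p + 1 then M i else M (p + 2) + M (p + 3)
    have hrec (j : ℕ) (hj : j < p + 1) : d j = 2 * M' (j + 1) - M' j - M' (j + 2) := by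
      have := hM ⟨j, by omega⟩
      grind
    have hM0 : M' 0 = 0 := by simp [M', h0]
    have h1 := eq_chainSolution hM0 hrec (j := p + 2) (by omega)
    have h2 := eq_chainSolution hM0 hrec (j := p + 1) (by omega)
    have h3 : d (p + 1) = 2 * M (p + 2) - M (p + 1) := by simpa using hM ⟨p + 1, by omega⟩
    have h4 : d (p + 2) = 2 * M (p + 3) - M (p + 1) := by simpa using hM ⟨p + 2, by omega⟩
    have h5 : M' (p + 1) = M (p + 1) := by simp [M']
    have h6 : M' (p + 2) = M (p + 2) + M (p + 3) := by simp [M']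
    rw [chainSolution_succ, ← h2, h5, h6] at h1
    rw [chainSolution, h5] at h2
    push_cast at h2
    -- The quotients by `4` are the fork coordinates themselves, as the converse will reuse.
    refine ⟨⟨M (p + 2) - M (p + 3), by linarith⟩, ⟨M (p + 2), ?_⟩, ⟨M (p + 3), ?_⟩⟩
    · linear_combination (p + 3) * h3 + (p + 1) * h4 - 2 * h2 + 2 * (p + 1) * h1
    · linear_combination (p + 1) * h3 + (p + 3) * h4 - 2 * h2 + 2 * (p + 1) * h1
  · rintro ⟨⟨t, ht⟩, ⟨x, hx⟩, ⟨y, hy⟩⟩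
    -- With fork coordinates `x` and `y`, the increment from `p + 1` to `p + 2` must be `x + y - (2
    -- * x - d (p + 1))`, which is `d (p + 2) + t`.
    set s := ∑ i ∈ Finset.range (p + 1), d i + d (p + 2) + t with hs
    have h1 : chainSolution d s (p + 1) = 2 * x - d (p + 1) := by
      -- The hypothesis `hx` contains twice the weighted sum, so the identity is proved doubled.
      have h : 2 * chainSolution d s (p + 1) = 2 * (2 * x - d (p + 1)) := by
        rw [chainSolution, hs]
        push_cast
        linear_combination hx - (p + 1) * ht
      linarith
    have h2 : chainSolution d s (p + 2) = x + y := by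
      rw [chainSolution_succ, h1, hs]
      linarith
    obtain ⟨M, hM⟩ : ∃ M : ℕ → ℤ, ∀ i, M i =
      if i ≤ p + 1 then chainSolution d s i else if i = p + 2 then x else y := ⟨_, fun _ => rfl⟩
    have h0 : M 0 = 0 := by simp [hM, chainSolution_zero]
    refine ⟨M, h0, fun j => ?_⟩
    rw [sum_mul_cartanMatrix_D h0]
    simp only [hM]
    have h := chainSolution_add_two d s j
    obtain ⟨j, hj⟩ := j
    rcases (by omega : j < p ∨ j = p ∨ j = p + 1 ∨ j = p + 2) with hjp | rfl | rfl | rfl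
    · simp only [show j + 1 ≤ p + 1 by omega, show j ≤ p + 1 by omega, show j + 2 ≤ p + 1 by omega,
        hjp, if_true]
      linarith
    · simp
      linarith
    · simp
      linarith
    · simp
      linarith

end ShiVariety

namespace ShiVariety

/-! ### Reduction modulo `2` and `4` -/

theorem intCast_sum_range_mul_zmod_two (n : ℕ) (f : ℕ → ℤ) :
    ((∑ j ∈ Finset.range n, ((j : ℤ) + 1) * f j : ℤ) : ZMod 2)
      = ∑ j ∈ Finset.univ.filter (fun j : Fin n => Odd ((j : ℕ) + 1)), (f j : ZMod 2) := by
  rw [Finset.sum_filter,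
    Fin.sum_univ_eq_sum_range (fun j => if Odd (j + 1) then (f j : ZMod 2) else 0), Int.cast_sum]
  refine Finset.sum_congr rfl fun j _ => ?_
  split_ifs with h
  · obtain ⟨t, ht⟩ := h
    rw [← sub_eq_zero, ← Int.cast_sub, ZMod.intCast_zmod_eq_zero_iff_dvd]
    have ht' : (j : ℤ) + 1 = 2 * t + 1 := by exact_mod_cast ht
    exact ⟨t * f j, by push_cast; linear_combination f j * ht'⟩
  · obtain ⟨t, ht⟩ := Nat.not_odd_iff_even.1 h
    rw [ZMod.intCast_zmod_eq_zero_iff_dvd]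
    have ht' : (j : ℤ) + 1 = t + t := by exact_mod_cast ht
    exact ⟨t * f j, by push_cast; linear_combination f j * ht'⟩

/-- Modulo `4`, `2 (j + 1)` depends only on the parity of `j + 1`. The cutoff `m` omits the fork
nodes of type `D`. -/
theorem intCast_two_mul_sum_range_mul_zmod_four {m n : ℕ} (hmn : m ≤ n) (f : ℕ → ℤ) :
    ((2 * ∑ j ∈ Finset.range m, ((j : ℤ) + 1) * f j : ℤ) : ZMod 4)
      = ∑ j ∈ Finset.univ.filter (fun j : Fin n => Odd ((j : ℕ) + 1) ∧ (j : ℕ) + 1 ≤ m),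
          2 * (f j : ZMod 4) := by
  rw [Finset.sum_filter, Fin.sum_univ_eq_sum_range
      (fun j => if Odd (j + 1) ∧ j + 1 ≤ m then 2 * (f j : ZMod 4) else 0),
    ← Finset.sum_subset (Finset.range_subset_range.2 hmn)
      (fun j _ hj => if_neg fun h => hj (Finset.mem_range.2 h.2)), Finset.mul_sum, Int.cast_sum]
  refine Finset.sum_congr rfl fun j hj => ?_
  have hj' : j + 1 ≤ m := Finset.mem_range.1 hj
  simp only [hj', and_true]
  split_ifs with h
  · obtain ⟨t, ht⟩ := h
    rw [show (2 : ZMod 4) * (f j : ZMod 4) = ((2 * f j : ℤ) : ZMod 4) by push_cast; rfl,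
      ← sub_eq_zero, ← Int.cast_sub, ZMod.intCast_zmod_eq_zero_iff_dvd]
    have ht' : (j : ℤ) + 1 = 2 * t + 1 := by exact_mod_cast ht
    exact ⟨t * f j, by push_cast; linear_combination 2 * f j * ht'⟩
  · obtain ⟨t, ht⟩ := Nat.not_odd_iff_even.1 h
    rw [ZMod.intCast_zmod_eq_zero_iff_dvd]
    have ht' : (j : ℤ) + 1 = t + t := by exact_mod_cast ht
    exact ⟨t * f j, by push_cast; linear_combination 2 * f j * ht'⟩

/-- Extension by zero of a vector to a sequence. -/
theorem exists_seq_eq {n : ℕ} (d : Fin n → ℤ) : ∃ e : ℕ → ℤ, ∀ i : Fin n, e i = d i :=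
  ⟨fun i => if h : i < n then d ⟨i, h⟩ else 0, fun i => by simp⟩

end ShiVariety

/-! ### Congruence criteria for the four classical types -/

theorem mainTheorem2 {I V N : Type*} [Finite I] [AddCommGroup V] [Module ℝ V]
    [AddCommGroup N] [Module ℝ N] (P : RootPairing I ℝ V N) [P.IsCrystallographic] [P.IsReduced]
    (b : P.Base) (n : ℕ) (α : Fin n ≃ b.support)
    (w w' : ShiVariety.affineWeylGroup P) (hww' : ShiVariety.SameComponent b w w') :
    let k : Fin n → ℤ := fun i => ShiVariety.shiCoeff b w (ShiVariety.simpleRoot b (α i))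
    let k' : Fin n → ℤ := fun i => ShiVariety.shiCoeff b w' (ShiVariety.simpleRoot b (α i))
    -- type `A_n`
    (1 ≤ n → ShiVariety.HasCartanMatrix b α (CartanMatrix.A n) →
      (ShiVariety.SameOrientation P w w' ↔
        ∑ j : Fin n, ((j : ℕ) + 1 : ZMod (n + 1)) * (k j : ZMod (n + 1)) =
          ∑ j : Fin n, ((j : ℕ) + 1 : ZMod (n + 1)) * (k' j : ZMod (n + 1)))) ∧
    -- type `B_n`
    (∀ hn : 2 ≤ n, ShiVariety.HasCartanMatrix b α (CartanMatrix.B n) →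
      (ShiVariety.SameOrientation P w w' ↔
        (k ⟨n - 1, by omega⟩ : ZMod 2) = (k' ⟨n - 1, by omega⟩ : ZMod 2))) ∧
    -- type `C_n`
    (2 ≤ n → ShiVariety.HasCartanMatrix b α (CartanMatrix.C n) →
      (ShiVariety.SameOrientation P w w' ↔
        ∑ j ∈ Finset.univ.filter (fun j : Fin n => Odd ((j : ℕ) + 1)), (k j : ZMod 2) =
          ∑ j ∈ Finset.univ.filter (fun j : Fin n => Odd ((j : ℕ) + 1)), (k' j : ZMod 2))) ∧
    -- type `D_n`
    (∀ hn : 4 ≤ n, ShiVariety.HasCartanMatrix b α (CartanMatrix.D n) →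
      (ShiVariety.SameOrientation P w w' ↔
        ((k ⟨n - 2, by omega⟩ : ZMod 2) - (k' ⟨n - 2, by omega⟩ : ZMod 2) =
          (k ⟨n - 1, by omega⟩ : ZMod 2) - (k' ⟨n - 1, by omega⟩ : ZMod 2)) ∧
        ((∑ j ∈ Finset.univ.filter (fun j : Fin n => Odd ((j : ℕ) + 1) ∧ (j : ℕ) + 1 ≤ n - 2),
              2 * (k j : ZMod 4))
            + (n : ZMod 4) * (k ⟨n - 2, by omega⟩ : ZMod 4)
            + ((n : ZMod 4) - 2) * (k ⟨n - 1, by omega⟩ : ZMod 4) =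
          (∑ j ∈ Finset.univ.filter (fun j : Fin n => Odd ((j : ℕ) + 1) ∧ (j : ℕ) + 1 ≤ n - 2),
              2 * (k' j : ZMod 4))
            + (n : ZMod 4) * (k' ⟨n - 2, by omega⟩ : ZMod 4)
            + ((n : ZMod 4) - 2) * (k' ⟨n - 1, by omega⟩ : ZMod 4)) ∧
        ((∑ j ∈ Finset.univ.filter (fun j : Fin n => Odd ((j : ℕ) + 1) ∧ (j : ℕ) + 1 ≤ n - 2),
              2 * (k j : ZMod 4))
            + ((n : ZMod 4) - 2) * (k ⟨n - 2, by omega⟩ : ZMod 4)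
            + (n : ZMod 4) * (k ⟨n - 1, by omega⟩ : ZMod 4) =
          (∑ j ∈ Finset.univ.filter (fun j : Fin n => Odd ((j : ℕ) + 1) ∧ (j : ℕ) + 1 ≤ n - 2),
              2 * (k' j : ZMod 4))
            + ((n : ZMod 4) - 2) * (k' ⟨n - 2, by omega⟩ : ZMod 4)
            + (n : ZMod 4) * (k' ⟨n - 1, by omega⟩ : ZMod 4)))) := by
  intro k k'
  obtain ⟨e, he⟩ := ShiVariety.exists_seq_eq fun i => k' i - k i
  have key {C : Matrix (Fin n) (Fin n) ℤ} (hC : ShiVariety.HasCartanMatrix b α C) :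
      ShiVariety.SameOrientation P w w' ↔ ∃ m : Fin n → ℤ, ∀ j : Fin n, e j = ∑ i, m i * C i j := by
    rw [ShiVariety.sameOrientation_iff_of_hasCartanMatrix b hww' α hC]
    simp only [he]
    rfl
  -- After `key`, only congruences between integer vectors remain.
  clear_value k k'
  refine ⟨fun _ hC => ?_, fun hn hC => ?_, fun hn hC => ?_, fun hn hC => ?_⟩
  · rw [key hC, ShiVariety.exists_row_A_iff, Finset.sum_range, eq_comm, ← sub_eq_zero (b := ∑ j, _),
      ← Finset.sum_sub_distrib]
    simp only [← mul_sub, he]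
    rw [show (n : ℤ) + 1 = ((n + 1 : ℕ) : ℤ) by push_cast; rfl, ← ZMod.intCast_zmod_eq_zero_iff_dvd]
    push_cast
    rfl
  · obtain ⟨p, rfl⟩ := Nat.exists_eq_add_of_le' (show 1 ≤ n by omega)
    rw [key hC, ShiVariety.exists_row_B_iff, eq_comm, ← sub_eq_zero, ← Int.cast_sub,
      ZMod.intCast_zmod_eq_zero_iff_dvd]
    have := he (Fin.last p)
    simp only [Fin.val_last] at this
    rw [this]
    rfl
  · obtain ⟨p, rfl⟩ := Nat.exists_eq_add_of_le' hn
    rw [key hC, ShiVariety.exists_row_C_iff, eq_comm, ← sub_eq_zero (b := Finset.sum _ _),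
      ← Finset.sum_sub_distrib]
    have h := ShiVariety.intCast_sum_range_mul_zmod_two (p + 2) e
    simp only [he, Int.cast_sub] at h
    rw [← h, ZMod.intCast_zmod_eq_zero_iff_dvd]
    rfl
  · obtain ⟨p, rfl⟩ := Nat.exists_eq_add_of_le' (show 3 ≤ n by omega)
    rw [key hC, ShiVariety.exists_row_D_iff]
    have h1 : e (p + 1) = k' ⟨p + 1, by omega⟩ - k ⟨p + 1, by omega⟩ := he ⟨p + 1, by omega⟩
    have h2 : e (p + 2) = k' ⟨p + 2, by omega⟩ - k ⟨p + 2, by omega⟩ := he ⟨p + 2, by omega⟩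
    have h := ShiVariety.intCast_two_mul_sum_range_mul_zmod_four (show p + 1 ≤ p + 3 by omega) e
    simp only [he, Int.cast_sub, mul_sub, Finset.sum_sub_distrib] at h
    simp only [show p + 3 - 2 = p + 1 by omega, show p + 3 - 1 = p + 2 by omega]
    refine and_congr ?_ (and_congr ?_ ?_)
    · refine (ZMod.intCast_zmod_eq_zero_iff_dvd _ 2).symm.trans ?_
      rw [h1, h2]
      push_cast
      constructor <;> intro h' <;> linear_combination -h'
    · refine (ZMod.intCast_zmod_eq_zero_iff_dvd _ 4).symm.trans ?_
      rw [Int.cast_add, Int.cast_add, h, h1, h2]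
      push_cast
      constructor <;> intro h' <;> linear_combination -h'
    · refine (ZMod.intCast_zmod_eq_zero_iff_dvd _ 4).symm.trans ?_
      rw [Int.cast_add, Int.cast_add, h, h1, h2]
      push_cast
      constructor <;> intro h' <;> linear_combination -h'
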